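/- Let $\mathbb{R}_+=[0,\infty)$ and let $\mathscr{S}$ be the space of tempered radial test functions, i.e. of all $\varphi\in C^\infty(\mathbb{R}_+)$ (real-valued, with one-sided derivatives at $0$) such that $\sup_{x\in\mathbb{R}_+}|x^\alpha\varphi^{(\beta)}(x)|<\infty$ for all $\alpha,\beta\in\mathbb{N}=\{0,1,2,\dots\}$. For an integer $d\ge 1$ and a function $\varphi$ on $\mathbb{R}_+$ let $$\mathscr{F}_d\varphi(r)=r^{-(d-2)/2}\int_0^\infty\varphi(t)\,t^{d/2}J_{(d-2)/2}(tr)\,dt,\qquad r\ge 0,$$ be the $d$-variate (radial) Fourier transform, where $J_\nu(x)=(x/2)^\nu H_\nu(x^2/4)$ is the Bessel function of the first kind, $H_\nu(x)=\sum_{k=0}^\infty\frac{(-x)^k}{k!\,\Gamma(k+\nu+1)}$, and the kernel $r^{-(d-2)/2}t^{d/2}J_{(d-2)/2}(tr)=2^{-(d-2)/2}\,t^{d-1}H_{(d-2)/2}(t^2r^2/4)$ is given at $r=0$ by the right-hand side. Let $\mathfrak{f}\varphi(r)=\varphi(\sqrt{2r})$ and $\mathfrak{f}^{-1}\varphi(r)=\varphi(r^2/2)$,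 and let $$I_{1/2}\psi(r)=\int_r^\infty\frac{(x-r)^{-1/2}}{\Gamma(1/2)}\,\psi(x)\,dx,\qquad I_{-1/2}\psi=I_{1/2}(-\psi').$$ Put $\mathscr{D}^{1/2}=\mathfrak{f}^{-1}I_{-1/2}\mathfrak{f}$ and $\mathscr{I}^{1/2}=\mathfrak{f}^{-1}I_{1/2}\mathfrak{f}$. Theorem. Let $\varphi\in\mathscr{S}$. Then $\mathfrak{f}\varphi$ is differentiable on $(0,\infty)$, the integrals defining $\mathscr{D}^{1/2}\varphi(t)$ for $t>0$ and $\mathscr{I}^{1/2}\varphi(t)$ for $t\ge 0$ converge absolutely, and so do those defining the Fourier transforms below for every $r\ge 0$. Moreover $$\mathscr{F}_d\varphi(r)=\mathscr{F}_{d+1}\mathscr{D}^{1/2}\varphi(r)\qquad\text{for every integer } d\ge 1 \text{ and every } r\ge 0,$$ $$\mathscr{F}_d\varphi(r)=\mathscr{F}_{d-1}\mathscr{I}^{1/2}\varphi(r)\qquad\text{for every integer } d\ge 2 \text{ and every } r\ge 0.$$ -/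

import Mathlib

open Set MeasureTheory
open scoped ContDiff

noncomputable section

/-! Functions on `[0, ∞)` are represented by functions `ℝ → ℝ` of which only the values
on `[0, ∞)` are used; in particular derivatives at `0` are one-sided. -/

/-- The space `𝒮` of tempered radial test functions: smooth functions on `[0, ∞)` such that
all derivatives decay faster than any polynomial. -/
def TemperedRadial : Set (ℝ → ℝ) :=
  {f | ContDiffOn ℝ ∞ f (Ici 0) ∧
    ∀ α β : ℕ, ∃ C : ℝ, ∀ x : ℝ, 0 ≤ x → |x ^ α * iteratedDerivWithin β f (Ici 0) x| ≤ C}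

/-- `H_ν(x) = ∑ₖ (-x)ᵏ / (k! Γ(k + ν + 1))`. The convention `1 / Γ(-m) = 0` for `m ∈ ℕ`
is the one of Mathlib. -/
def besselH (ν x : ℝ) : ℝ :=
  ∑' k : ℕ, (-x) ^ k / ((k.factorial : ℝ) * Real.Gamma (k + ν + 1))

/-- The Bessel function of the first kind `J_ν(x)`, for `x > 0`. -/
def besselJ (ν x : ℝ) : ℝ :=
  (x / 2) ^ ν * besselH ν (x ^ 2 / 4)

/-- The kernel `r^{-ν} t^{d/2} J_ν(tr)`, `ν = (d-2)/2`, of the `d`-variate Fourier transform,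
written in terms of `H_ν` so that it also has its proper (limit) value at `r = 0`;
see `radialKernel_eq_besselJ`. -/
def radialKernel (d : ℕ) (r t : ℝ) : ℝ :=
  (2 : ℝ) ^ (-(((d : ℝ) - 2) / 2)) * t ^ ((d : ℝ) - 1) *
    besselH (((d : ℝ) - 2) / 2) ((t * r) ^ 2 / 4)

theorem radialKernel_eq_besselJ (d : ℕ) {r t : ℝ} (hr : 0 < r) (ht : 0 < t) :
    radialKernel d r t =
      r ^ (-(((d : ℝ) - 2) / 2)) * (t ^ ((d : ℝ) / 2) * besselJ (((d : ℝ) - 2) / 2) (t * r)) := by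
  unfold radialKernel besselJ
  rw [Real.div_rpow (by positivity) (by norm_num), Real.mul_rpow ht.le hr.le,
    show (d : ℝ) - 1 = (d : ℝ) / 2 + ((d : ℝ) - 2) / 2 by ring, Real.rpow_add ht,
    Real.rpow_neg hr.le, Real.rpow_neg (by norm_num : (0 : ℝ) ≤ 2)]
  have h : r ^ (((d : ℝ) - 2) / 2) ≠ 0 := (Real.rpow_pos_of_pos hr _).ne'
  field_simp

/-- The `d`-variate Fourier transform `ℱ_d φ` of a radial function `φ`. -/
def radialFourier (d : ℕ) (φ : ℝ → ℝ) (r : ℝ) : ℝ :=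
  ∫ t in Ioi (0 : ℝ), φ t * radialKernel d r t

/-- The defining formula `ℱ_d φ(r) = r^{-(d-2)/2} ∫₀^∞ φ(t) t^{d/2} J_{(d-2)/2}(tr) dt`. -/
theorem radialFourier_eq_besselJ (d : ℕ) (φ : ℝ → ℝ) {r : ℝ} (hr : 0 < r) :
    radialFourier d φ r =
      r ^ (-(((d : ℝ) - 2) / 2)) *
        ∫ t in Ioi (0 : ℝ), φ t * t ^ ((d : ℝ) / 2) * besselJ (((d : ℝ) - 2) / 2) (t * r) := by
  unfold radialFourier
  rw [← integral_const_mul]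
  refine setIntegral_congr_fun measurableSet_Ioi fun t ht => ?_
  simp only [radialKernel_eq_besselJ d hr ht]
  ring

/-- The integral defining `ℱ_d φ(r)` converges absolutely for every `r ≥ 0`. -/
def RadialFourierExists (d : ℕ) (φ : ℝ → ℝ) : Prop :=
  ∀ r : ℝ, 0 ≤ r → IntegrableOn (fun t => φ t * radialKernel d r t) (Ioi 0)

/-- The `f`-form `r ↦ φ(√(2r))`. -/
def fform (φ : ℝ → ℝ) (r : ℝ) : ℝ := φ (√(2 * r))

/-- The inverse `f`-form `r ↦ φ(r²/2)`. -/
def fformInv (φ : ℝ → ℝ) (r : ℝ) : ℝ := φ (r ^ 2 / 2)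

/-- The integrand of the fractional integral `I_ν φ(r)`, `ν > 0`. -/
def fracIntegrand (ν : ℝ) (φ : ℝ → ℝ) (r x : ℝ) : ℝ :=
  (x - r) ^ (ν - 1) / Real.Gamma ν * φ x

/-- The fractional integral operators `I_ν`, `ν ≥ 0`, with `I_0 = id`. -/
def fracIntegral (ν : ℝ) (φ : ℝ → ℝ) (r : ℝ) : ℝ :=
  if ν = 0 then φ r else ∫ x in Ioi r, fracIntegrand ν φ r x

/-- The operator `I_{-1} = -d/dr` on functions on `[0, ∞)`. -/
def negDeriv (φ : ℝ → ℝ) (r : ℝ) : ℝ := -derivWithin φ (Ici 0) r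

/-- The operators `I_μ` for all real `μ`: fractional integrals for `μ ≥ 0`, and
`I_{-ν} = I_{n-ν} I_{-1}^n` with `n = ⌈ν⌉` for `ν > 0`. -/
def fracOp (μ : ℝ) (φ : ℝ → ℝ) : ℝ → ℝ :=
  if 0 ≤ μ then fracIntegral μ φ
  else fracIntegral ((⌈-μ⌉₊ : ℝ) + μ) (negDeriv^[⌈-μ⌉₊] φ)

/-- The half-step differential operator `𝒟^{1/2} = f⁻¹ I_{-1/2} f`. -/
def halfD (φ : ℝ → ℝ) : ℝ → ℝ := fformInv (fracOp (-1 / 2) (fform φ))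

/-- The half-step integral operator `𝓘^{1/2} = f⁻¹ I_{1/2} f`. -/
def halfI (φ : ℝ → ℝ) : ℝ → ℝ := fformInv (fracOp (1 / 2) (fform φ))

end

/-! Put `ν = (d - 2) / 2`. The substitution `s = t² / 2` turns `ℱ_d ψ(r)` into the integral over
`(0, ∞)` of the f-form of `ψ` against `s ^ ν * besselH ν (c * s)` with `c = r² / 2`, so the
dimension enters only through `ν`.

By the Beta integral, applied to the power series term by term, the order-`a` fractional integral
based at `0` raises `ν` to `ν + a` in this kernel (`setIntegral_rpow_mul_besselH`). By Fubini, its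
adjoint is the operator `I_a` integrating out to infinity (`integral_fracIntegral_mul`). Hence `I_a
h` paired with the kernel of order `ν` equals `h` paired with the kernel of order `ν + a`.

With `a = 1/2` and `h` the f-form `g` of `φ`, this is the walk for `𝓘^{1/2}`. For `𝒟^{1/2}` take `h
= -g'`: pairing `I_{1/2} h` at order `ν + 1/2` and `I_1 h = g` at order `ν` both give `h` at order
`ν + 1`.

Absolute convergence rests on the boundedness of `besselH ν` on `[0, ∞)` for the orders in question
(`abs_besselH_le`) and on the decay of `g` and `g'`, where `g'` is `O(s ^ (-1/2))` at `0`. -/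

/-! ### Beta integrals and the functions `besselH`. -/

theorem setIntegral_rpow_mul_rpow {a b x : ℝ} (ha : 0 < a) (hb : -1 < b) (hx : 0 < x) :
    ∫ u in Ioo 0 x, (x - u) ^ (a - 1) / Real.Gamma a * u ^ b =
      Real.Gamma (b + 1) / Real.Gamma (b + a + 1) * x ^ (b + a) := by
  have h1 := Complex.betaIntegral_scaled (b + 1 : ℝ) a hx
  rw [intervalIntegral.integral_of_le hx.le, integral_Ioc_eq_integral_Ioo] at h1
  have h2 : ∫ u in Ioo 0 x, ((u : ℂ) ^ (((b + 1 : ℝ) : ℂ) - 1) * ((x : ℂ) - u) ^ ((a : ℂ) - 1)) =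
      ∫ u in Ioo 0 x, (((x - u) ^ (a - 1) * u ^ b : ℝ) : ℂ) := by
    refine setIntegral_congr_fun measurableSet_Ioo fun u hu => ?_
    rw [Complex.ofReal_mul, Complex.ofReal_cpow (sub_pos.2 hu.2).le, Complex.ofReal_cpow hu.1.le,
      mul_comm]
    push_cast
    ring_nf
  rw [h2, integral_complex_ofReal, Complex.betaIntegral_eq_Gamma_mul_div _ _ (by simp; linarith)
    (by simpa using ha), ← Complex.ofReal_add, Complex.Gamma_ofReal, Complex.Gamma_ofReal,
    Complex.Gamma_ofReal, ← Complex.ofReal_one, ← Complex.ofReal_sub,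
    ← Complex.ofReal_cpow hx.le] at h1
  have h3 : ∫ u in Ioo 0 x, (x - u) ^ (a - 1) * u ^ b =
      x ^ (b + 1 + a - 1) * (Real.Gamma (b + 1) * Real.Gamma a / Real.Gamma (b + 1 + a)) := by
    exact_mod_cast h1
  have h4 := (Real.Gamma_pos_of_pos ha).ne'
  calc _ = ∫ u in Ioo 0 x, (Real.Gamma a)⁻¹ * ((x - u) ^ (a - 1) * u ^ b) := by
        congr 1; ext u; ring
    _ = _ := by
        rw [integral_const_mul, h3, show b + 1 + a - 1 = b + a by ring,
          show b + 1 + a = b + a + 1 by ring]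
        field_simp

theorem integrableOn_rpow_mul_rpow {a b x : ℝ} (ha : 0 < a) (hb : -1 < b) (hx : 0 < x) :
    IntegrableOn (fun u => (x - u) ^ (a - 1) / Real.Gamma a * u ^ b) (Ioo 0 x) := by
  -- A non-integrable function has integral `0` by convention, but the Beta value is positive.
  by_contra h
  have h1 := setIntegral_rpow_mul_rpow ha hb hx
  rw [integral_undef h] at h1
  have h2 := Real.Gamma_pos_of_pos (show 0 < b + 1 by linarith)
  have h3 := Real.Gamma_pos_of_pos (show 0 < b + a + 1 by linarith)
  have : 0 < Real.Gamma (b + 1) / Real.Gamma (b + a + 1) * x ^ (b + a) := by positivity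
  linarith

theorem summable_besselH {ν : ℝ} (hν : -1 < ν) (y : ℝ) :
    Summable fun k : ℕ => (-y) ^ k / ((k.factorial : ℝ) * Real.Gamma (k + ν + 1)) := by
  refine Summable.of_norm_bounded_eventually_nat (Real.summable_pow_div_factorial |y|) ?_
  filter_upwards [Filter.eventually_ge_atTop 2] with k hk
  have hk' : (2 : ℝ) ≤ k := by exact_mod_cast hk
  -- `Γ` increases on `[2, ∞)` from `Γ(2) = 1`, so the exponential series dominates from `k = 2` on.
  have h1 : 1 ≤ Real.Gamma (k + ν + 1) := by
    have := Real.Gamma_strictMonoOn_Ici.monotoneOn (self_mem_Ici (a := (2 : ℝ)))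
      (show k + ν + 1 ∈ Ici (2 : ℝ) from by simp only [mem_Ici]; linarith) (by linarith)
    rwa [Real.Gamma_two] at this
  have h2 : 0 < Real.Gamma (k + ν + 1) := by linarith
  have h3 : 0 < (k.factorial : ℝ) := by positivity
  rw [norm_div, norm_pow, norm_neg, Real.norm_eq_abs, Real.norm_eq_abs, abs_of_pos (mul_pos h3 h2)]
  exact div_le_div_of_nonneg_left (by positivity) h3 (le_mul_of_one_le_right h3.le h1)

theorem measurable_besselH {ν : ℝ} (hν : -1 < ν) : Measurable (besselH ν) := by
  refine measurable_of_tendsto_metrizable (f := fun n y =>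
    ∑ k ∈ Finset.range n, (-y) ^ k / ((k.factorial : ℝ) * Real.Gamma (k + ν + 1)))
    (fun n => by fun_prop) (tendsto_pi_nhds.2 fun y => ?_)
  exact (summable_besselH hν y).hasSum.tendsto_sum_nat

/-- The fractional integral based at `0` of `u ^ ν * besselH ν (c * u)`. -/
theorem setIntegral_rpow_mul_besselH {a ν x : ℝ} (ha : 0 < a) (hν : -1 < ν) (hx : 0 < x) (c : ℝ) :
    ∫ u in Ioo 0 x, (x - u) ^ (a - 1) / Real.Gamma a * (u ^ ν * besselH ν (c * u)) =
      x ^ (ν + a) * besselH (ν + a) (c * x) := by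
  let F : ℝ → ℕ → ℝ → ℝ := fun c k u =>
    (-c) ^ k / ((k.factorial : ℝ) * Real.Gamma (k + ν + 1)) *
      ((x - u) ^ (a - 1) / Real.Gamma a * u ^ (k + ν))
  have hkν : ∀ k : ℕ, -1 < k + ν := fun k => by have := k.cast_nonneg (α := ℝ); linarith
  have hΓ : ∀ k : ℕ, 0 < Real.Gamma (k + ν + 1) := fun k =>
    Real.Gamma_pos_of_pos (by linarith [hkν k])
  have hint : ∀ c k, ∫ u in Ioo 0 x, F c k u =
      x ^ (ν + a) * ((-(c * x)) ^ k / ((k.factorial : ℝ) * Real.Gamma (k + (ν + a) + 1))) := by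
    intro c k
    simp only [F]
    rw [integral_const_mul, setIntegral_rpow_mul_rpow ha (hkν k) hx,
      show k + ν + a = k + (ν + a) by ring, Real.rpow_add hx, Real.rpow_natCast]
    have := (hΓ k).ne'
    rw [show -(c * x) = -c * x by ring, mul_pow]
    field_simp
  have hFi : ∀ c k, IntegrableOn (F c k) (Ioo 0 x) := fun c k =>
    (integrableOn_rpow_mul_rpow ha (hkν k) hx).const_mul _
  -- Taking norms amounts to replacing `c` by `-|c|`, so the norm integrals form a series of the
  -- same kind, already known to be summable.
  have hnorm : ∀ k, ∫ u in Ioo 0 x, ‖F c k u‖ = ∫ u in Ioo 0 x, F (-|c|) k u := by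
    intro k
    refine setIntegral_congr_fun measurableSet_Ioo fun u hu => ?_
    have h1 : 0 < x - u := sub_pos.2 hu.2
    have h2 : 0 < u := hu.1
    have h3 := Real.Gamma_pos_of_pos ha
    have h4 := hΓ k
    simp only [F, norm_mul, norm_div, norm_pow, norm_neg, Real.norm_eq_abs, neg_neg]
    rw [abs_of_pos h4, abs_of_pos h3, abs_of_pos (Real.rpow_pos_of_pos h1 _),
      abs_of_pos (Real.rpow_pos_of_pos h2 _), Nat.abs_cast]
  have hs := hasSum_integral_of_summable_integral_norm (μ := volume.restrict (Ioo 0 x))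
    (F := F c) (hFi c) (by
      simp_rw [hnorm, hint]
      exact (summable_besselH (by linarith) _).mul_left _)
  simp_rw [hint] at hs
  have h5 := hs.unique (((summable_besselH (show -1 < ν + a by linarith) (c * x)).hasSum).mul_left
    (x ^ (ν + a)))
  change _ = x ^ (ν + a) * besselH (ν + a) (c * x) at h5
  rw [← h5]
  refine setIntegral_congr_fun measurableSet_Ioo fun u hu => ?_
  simp only [F, besselH]
  rw [← tsum_mul_left, ← tsum_mul_left]
  refine tsum_congr fun k => ?_
  rw [Real.rpow_add hu.1, Real.rpow_natCast, show -(c * u) = -c * u by ring, mul_pow]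
  ring

/-- The case `d = 1`, where the Bessel kernel is a cosine; it starts the induction for the uniform
bound. -/
theorem besselH_neg_half (y : ℝ) : besselH (-(1 / 2)) (y ^ 2) = Real.cos (2 * y) / √Real.pi := by
  have h := (Real.hasSum_cos (2 * y)).div_const (√Real.pi)
  rw [← h.tsum_eq, besselH]
  refine tsum_congr fun k => ?_
  rw [show (k : ℝ) + -(1 / 2) + 1 = k + 1 / 2 by ring, Real.Gamma_nat_add_half]
  -- At `k = 0` the truncated `2 * k - 1` is `0`, and `0‼ = 1` is the right value.
  have hd : (((2 * k).factorial : ℕ) : ℝ) = 2 ^ k * k.factorial * (2 * k - 1).doubleFactorial := by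
    rcases k with _ | k
    · simp
    · have h1 := Nat.factorial_eq_mul_doubleFactorial (2 * k + 1)
      have h2 := Nat.doubleFactorial_two_mul (k + 1)
      rw [show 2 * k + 1 + 1 = 2 * (k + 1) by ring, h2] at h1
      rw [show 2 * (k + 1) - 1 = 2 * k + 1 by omega]
      exact_mod_cast h1
  have hd0 : (((2 * k - 1).doubleFactorial : ℕ) : ℝ) ≠ 0 := by
    exact_mod_cast (Nat.doubleFactorial_pos _).ne'
  have : √Real.pi ≠ 0 := (Real.sqrt_pos.2 Real.pi_pos).ne'
  rw [hd, show (-y ^ 2) = (-1) * y ^ 2 by ring, mul_pow, ← pow_mul, mul_pow, pow_mul 2 2 k]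
  have h4 : ((2 : ℝ) ^ 2) ^ k = 2 ^ k * 2 ^ k := by rw [← mul_pow]; norm_num
  rw [h4]
  field_simp

/-- Induction in half steps of the order: the fractional integral is positive, so a bound for
`besselH ν` by its value at `0` integrates, by the same Beta integral, to the bound for `ν + 1/2`.
-/
theorem abs_besselH_le (n : ℕ) {y : ℝ} (hy : 0 ≤ y) :
    |besselH (((n : ℝ) - 1) / 2) y| ≤ 1 / Real.Gamma (((n : ℝ) - 1) / 2 + 1) := by
  induction n generalizing y with
  | zero =>
    rw [show (((0 : ℕ) : ℝ) - 1) / 2 = -(1 / 2) by norm_num, ← Real.sq_sqrt hy, besselH_neg_half,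
      abs_div, abs_of_nonneg (Real.sqrt_nonneg _), show (-(1 / 2) + 1 : ℝ) = 1 / 2 by norm_num,
      Real.Gamma_one_half_eq]
    gcongr
    exact Real.abs_cos_le_one _
  | succ n ih =>
    have hν : -1 < ((n : ℝ) - 1) / 2 := by have := n.cast_nonneg (α := ℝ); linarith
    have e : (((n + 1 : ℕ) : ℝ) - 1) / 2 = ((n : ℝ) - 1) / 2 + 1 / 2 := by push_cast; ring
    rw [e]
    generalize ((n : ℝ) - 1) / 2 = ν at ih hν
    have h0 := Real.Gamma_pos_of_pos (show 0 < ν + 1 by linarith)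
    have h1 := Real.Gamma_pos_of_pos (show 0 < ν + 1 / 2 + 1 by linarith)
    rcases hy.eq_or_lt with rfl | hy
    · rw [besselH, tsum_eq_single 0 (by intro k hk; simp [hk])]
      simp [abs_of_pos (show 0 < Real.Gamma (ν + 2⁻¹ + 1) by simpa using h1)]
    · have h2 := setIntegral_rpow_mul_besselH (show (0 : ℝ) < 1 / 2 by norm_num) hν hy 1
      have h3 : ‖∫ u in Ioo 0 y, (y - u) ^ ((1 / 2 : ℝ) - 1) / Real.Gamma (1 / 2) *
          (u ^ ν * besselH ν (1 * u))‖ ≤ ∫ u in Ioo 0 y, 1 / Real.Gamma (ν + 1) *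
            ((y - u) ^ ((1 / 2 : ℝ) - 1) / Real.Gamma (1 / 2) * u ^ ν) := by
        refine norm_integral_le_of_norm_le
          ((integrableOn_rpow_mul_rpow (by norm_num) hν hy).const_mul _) ?_
        filter_upwards [ae_restrict_mem measurableSet_Ioo] with u hu
        have h4 : 0 < (y - u) ^ ((1 / 2 : ℝ) - 1) / Real.Gamma (1 / 2) * u ^ ν :=
          mul_pos (div_pos (Real.rpow_pos_of_pos (sub_pos.2 hu.2) _)
            (Real.Gamma_pos_of_pos (by norm_num))) (Real.rpow_pos_of_pos hu.1 _)
        rw [← mul_assoc, norm_mul, Real.norm_of_nonneg h4.le, mul_comm, one_mul]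
        exact mul_le_mul_of_nonneg_right (ih hu.1.le) h4.le
      rw [h2, integral_const_mul, setIntegral_rpow_mul_rpow (by norm_num) hν hy, norm_mul,
        Real.norm_of_nonneg (Real.rpow_nonneg hy.le _), one_mul, Real.norm_eq_abs] at h3
      have h5 := Real.rpow_pos_of_pos hy (ν + 1 / 2)
      refine le_of_mul_le_mul_left (h3.trans_eq ?_) h5
      field_simp

/-! ### The adjoint of the fractional integral. -/

/-- Fubini's theorem for the fractional integral `I_a h` against a kernel `k` of growth `s ^ ν`. -/
theorem integral_fracIntegral_mul {a ν C : ℝ} {h k : ℝ → ℝ} (ha : 0 < a) (hν : -1 < ν)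
    (hh : AEStronglyMeasurable h (volume.restrict (Ioi 0))) (hk : Measurable k)
    (hkC : ∀ s, 0 < s → |k s| ≤ C * s ^ ν)
    (hint : IntegrableOn (fun x => h x * x ^ (ν + a)) (Ioi 0)) :
    IntegrableOn (fun s => (∫ x in Ioi s, fracIntegrand a h s x) * k s) (Ioi 0) ∧
      ∫ s in Ioi 0, (∫ x in Ioi s, fracIntegrand a h s x) * k s =
        ∫ x in Ioi 0, h x * ∫ s in Ioo 0 x, (x - s) ^ (a - 1) / Real.Gamma a * k s := by
  let w : ℝ → ℝ → ℝ := fun x s => (x - s) ^ (a - 1) / Real.Gamma a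
  -- `F` keeps `k` as an argument so that its instance at `s ^ ν` can serve as the dominating
  -- function.
  let F : (ℝ → ℝ) → ℝ × ℝ → ℝ := fun k =>
    {p : ℝ × ℝ | p.2 < p.1}.indicator fun p => h p.1 * (w p.1 p.2 * k p.2)
  let μ := volume.restrict (Ioi (0 : ℝ))
  have hset : MeasurableSet {p : ℝ × ℝ | p.2 < p.1} := measurableSet_lt measurable_snd measurable_fst
  have hwm : Measurable fun p : ℝ × ℝ => w p.1 p.2 := by fun_prop
  have hFm : ∀ k : ℝ → ℝ, Measurable k → AEStronglyMeasurable (F k) (μ.prod μ) := fun k hk =>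
    ((hh.comp_fst).mul (hwm.mul (hk.comp measurable_snd)).aestronglyMeasurable).indicator hset
  have hFx : ∀ k x, (fun s => F k (x, s)) = (Iio x).indicator fun s => h x * (w x s * k s) := by
    intro k x; ext s; simp [F, indicator_apply]
  have hFs : ∀ k s, (fun x => F k (x, s)) = (Ioi s).indicator fun x => h x * (w x s * k s) := by
    intro k s; ext x; simp [F, indicator_apply]
  have hw : ∀ x s, s < x → 0 < w x s := fun x s hs =>
    div_pos (Real.rpow_pos_of_pos (sub_pos.2 hs) _) (Real.Gamma_pos_of_pos ha)
  have hI : ∀ x : ℝ, Iio x ∩ Ioi 0 = Ioo 0 x := fun x => by ext; simp [and_comm]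
  have hpow : Integrable (F fun s => s ^ ν) (μ.prod μ) := by
    rw [integrable_prod_iff (hFm (fun s => s ^ ν) (by fun_prop))]
    constructor
    · filter_upwards [ae_restrict_mem measurableSet_Ioi] with x hx
      rw [hFx (fun s => s ^ ν), integrable_indicator_iff measurableSet_Iio, IntegrableOn,
        Measure.restrict_restrict measurableSet_Iio, hI]
      exact (integrableOn_rpow_mul_rpow ha hν hx).const_mul _
    · refine (hint.norm.mul_const (Real.Gamma (ν + 1) / Real.Gamma (ν + a + 1))).congr ?_
      filter_upwards [ae_restrict_mem measurableSet_Ioi] with x hx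
      have e : (fun s => ‖F (fun s => s ^ ν) (x, s)‖) =
          (Iio x).indicator fun s => ‖h x * (w x s * s ^ ν)‖ := by
        ext s
        rw [show F (fun s => s ^ ν) (x, s) = _ from congrFun (hFx (fun s => s ^ ν) x) s,
          norm_indicator_eq_indicator_norm]
      rw [e, integral_indicator measurableSet_Iio, Measure.restrict_restrict measurableSet_Iio, hI]
      have e2 : ∫ s in Ioo 0 x, ‖h x * (w x s * s ^ ν)‖ =
          ∫ s in Ioo 0 x, ‖h x‖ * (w x s * s ^ ν) := by
        refine setIntegral_congr_fun measurableSet_Ioo fun s hs => ?_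
        rw [norm_mul, Real.norm_of_nonneg (mul_pos (hw x s hs.2) (Real.rpow_pos_of_pos hs.1 _)).le]
      rw [e2, integral_const_mul, setIntegral_rpow_mul_rpow ha hν hx, norm_mul,
        Real.norm_of_nonneg (Real.rpow_nonneg (le_of_lt hx) _)]
      ring
  have hF : Integrable (F k) (μ.prod μ) := by
    refine Integrable.mono' (hpow.norm.const_mul C) (hFm k hk) ?_
    have hpos : ∀ᵐ p ∂(μ.prod μ), 0 < p.2 :=
      Measure.quasiMeasurePreserving_snd.ae (ae_restrict_mem (μ := volume) measurableSet_Ioi)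
    filter_upwards [hpos] with p hp
    by_cases hlt : p.2 < p.1
    · have h1 : ∀ k, F k p = h p.1 * (w p.1 p.2 * k p.2) := fun k => by
        simp [F, hlt]
      rw [h1 k, h1 fun s => s ^ ν]
      simp only [norm_mul, Real.norm_eq_abs]
      rw [abs_of_pos (Real.rpow_pos_of_pos hp ν)]
      calc _ ≤ |h p.1| * (|w p.1 p.2| * (C * p.2 ^ ν)) := by gcongr; exact hkC _ hp
        _ = _ := by ring
    · simp [F, hlt]
  have hs : ∀ s ∈ Ioi (0 : ℝ), ∫ x, F k (x, s) ∂μ = (∫ x in Ioi s, fracIntegrand a h s x) * k s := by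
    intro s hs
    rw [hFs, integral_indicator measurableSet_Ioi, Measure.restrict_restrict measurableSet_Ioi,
      inter_eq_left.2 (Ioi_subset_Ioi (le_of_lt hs)), ← integral_mul_const]
    congr 1; ext x; simp only [fracIntegrand, w]; ring
  have hx : ∀ x, ∫ s, F k (x, s) ∂μ =
      h x * ∫ s in Ioo 0 x, (x - s) ^ (a - 1) / Real.Gamma a * k s := by
    intro x
    rw [hFx, integral_indicator measurableSet_Iio, Measure.restrict_restrict measurableSet_Iio, hI,
      integral_const_mul]
  constructor
  · refine hF.integral_prod_right.congr ?_
    filter_upwards [ae_restrict_mem measurableSet_Ioi] with s h using hs s h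
  · rw [← setIntegral_congr_fun measurableSet_Ioi hs]
    change ∫ s, ∫ x, F k (x, s) ∂μ ∂μ = _
    rw [integral_integral_swap (f := fun s x => F k (x, s)) hF.swap]
    exact integral_congr_ae (Filter.Eventually.of_forall hx)

/-! ### Integrability of rapidly decaying functions. -/

/-- Functions on `(0, ∞)` that decay faster than any power at infinity and grow at most like
`s ^ (-b)` at `0`. -/
structure RapidDecay (b : ℝ) (h : ℝ → ℝ) : Prop where
  aestronglyMeasurable : AEStronglyMeasurable h (volume.restrict (Ioi 0))
  bound : ∀ N : ℕ, ∃ C : ℝ, ∀ s, 0 < s → s ^ N * |h s| ≤ C * s ^ (-b)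

namespace RapidDecay

variable {b : ℝ} {h : ℝ → ℝ}

theorem integrableOn_mul_rpow (hh : RapidDecay b h) {p : ℝ} (hp : b - 1 < p) :
    IntegrableOn (fun x => h x * x ^ p) (Ioi 0) := by
  have hm : AEStronglyMeasurable (fun x => h x * x ^ p) (volume.restrict (Ioi 0)) :=
    hh.aestronglyMeasurable.mul (by fun_prop : Measurable fun x : ℝ => x ^ p).aestronglyMeasurable
  rw [← Ioc_union_Ioi_eq_Ioi zero_le_one] at hm ⊢
  refine IntegrableOn.union ?_ ?_
  · obtain ⟨C, hC⟩ := hh.bound 0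
    have hi : IntegrableOn (fun x : ℝ => C * x ^ (p - b)) (Ioc 0 1) :=
      (((intervalIntegrable_iff_integrableOn_Ioc_of_le zero_le_one).1
        (intervalIntegral.intervalIntegrable_rpow' (by linarith)))).const_mul C
    refine Integrable.mono' hi (hm.mono_measure (Measure.restrict_mono subset_union_left le_rfl)) ?_
    filter_upwards [ae_restrict_mem measurableSet_Ioc] with x hx
    have h1 := hC x hx.1
    rw [norm_mul, Real.norm_of_nonneg (Real.rpow_nonneg hx.1.le _), Real.norm_eq_abs,
      sub_eq_neg_add, Real.rpow_add hx.1, ← mul_assoc]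
    gcongr
    · exact Real.rpow_nonneg hx.1.le _
    · simpa using h1
  -- This `N` makes the exponent `p - b - N` less than `-1`.
  · obtain ⟨N, hN⟩ := exists_nat_gt (p - b + 1)
    obtain ⟨C, hC⟩ := hh.bound N
    have hi : IntegrableOn (fun x : ℝ => C * x ^ (p - b - N)) (Ioi 1) :=
      (integrableOn_Ioi_rpow_of_lt (by linarith) one_pos).const_mul C
    refine Integrable.mono' hi (hm.mono_measure (Measure.restrict_mono subset_union_right le_rfl)) ?_
    filter_upwards [ae_restrict_mem measurableSet_Ioi] with x hx
    have hx0 : 0 < x := one_pos.trans hx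
    have h1 := hC x hx0
    have hN0 := Real.rpow_pos_of_pos hx0 N
    rw [norm_mul, Real.norm_of_nonneg (Real.rpow_nonneg hx0.le _), Real.norm_eq_abs,
      Real.rpow_sub hx0, sub_eq_neg_add, Real.rpow_add hx0, ← mul_div_assoc, le_div_iff₀ hN0,
      Real.rpow_natCast]
    calc |h x| * x ^ p * x ^ N = (x ^ N * |h x|) * x ^ p := by ring
      _ ≤ (C * x ^ (-b)) * x ^ p := by gcongr
      _ = _ := by ring

theorem integrableOn_fracIntegrand (hh : RapidDecay b h) (hb : 0 ≤ b) {a s : ℝ} (ha : 0 < a)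
    (ha1 : a ≤ 1) (hs : 0 < s) : IntegrableOn (fracIntegrand a h s) (Ioi s) := by
  have hm : AEStronglyMeasurable (fracIntegrand a h s) (volume.restrict (Ioi s)) :=
    (by fun_prop : Measurable fun x => (x - s) ^ (a - 1) / Real.Gamma a).aestronglyMeasurable.mul
      (hh.aestronglyMeasurable.mono_measure (Measure.restrict_mono (Ioi_subset_Ioi hs.le) le_rfl))
  have hΓ := Real.Gamma_pos_of_pos ha
  have hs1 : s ≤ s + 1 := by linarith
  rw [← Ioc_union_Ioi_eq_Ioi hs1] at hm ⊢
  refine IntegrableOn.union ?_ ?_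
  · obtain ⟨C, hC⟩ := hh.bound 0
    have hi : IntegrableOn (fun x : ℝ => (x - s) ^ (a - 1) / Real.Gamma a * (C * s ^ (-b)))
        (Ioc s (s + 1)) := by
      refine (Integrable.div_const ?_ _).mul_const _
      have := (intervalIntegral.intervalIntegrable_rpow' (a := 0) (b := 1)
        (show -1 < a - 1 by linarith)).comp_sub_right s
      rw [zero_add, add_comm, intervalIntegrable_iff_integrableOn_Ioc_of_le hs1] at this
      exact this
    refine Integrable.mono' hi (hm.mono_measure (Measure.restrict_mono subset_union_left le_rfl)) ?_
    filter_upwards [ae_restrict_mem measurableSet_Ioc] with x hx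
    have hx0 : 0 < x := hs.trans hx.1
    have h1 := hC x hx0
    have h2 : x ^ (-b) ≤ s ^ (-b) := Real.rpow_le_rpow_of_nonpos hs hx.1.le (by linarith)
    have hC0 : 0 ≤ C := by
      have h3 : 0 ≤ C * x ^ (-b) := le_trans (by positivity) h1
      exact nonneg_of_mul_nonneg_left h3 (Real.rpow_pos_of_pos hx0 _)
    have h4 : 0 < x - s := sub_pos.2 hx.1
    rw [fracIntegrand, norm_mul, Real.norm_of_nonneg (by positivity), Real.norm_eq_abs]
    gcongr
    rw [pow_zero, one_mul] at h1
    exact h1.trans (by gcongr)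
  -- Away from the singularity the kernel is at most `1 / Γ(a)`, and `1 ≤ s ^ (-b) * x ^ b` brings
  -- in the power that makes `h` integrable.
  · have hi : IntegrableOn (fun x => (1 / Real.Gamma a * s ^ (-b)) * |h x * x ^ b|)
        (Ioi (s + 1)) :=
      (((hh.integrableOn_mul_rpow (p := b) (by linarith)).mono_set
        (Ioi_subset_Ioi (by linarith))).norm).const_mul _
    refine Integrable.mono' hi (hm.mono_measure (Measure.restrict_mono subset_union_right le_rfl)) ?_
    filter_upwards [ae_restrict_mem measurableSet_Ioi] with x hx
    have hx1 : 1 ≤ x - s := by have : s + 1 < x := hx; linarith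
    have hx0 : 0 < x := by linarith
    have hxs : s ≤ x := by linarith
    have h2 : s ^ b ≤ x ^ b := Real.rpow_le_rpow hs.le hxs hb
    have h3 : (x - s) ^ (a - 1) ≤ 1 := Real.rpow_le_one_of_one_le_of_nonpos hx1 (by linarith)
    have h4 := Real.rpow_pos_of_pos hs b
    rw [fracIntegrand, norm_mul, Real.norm_of_nonneg (by positivity), Real.norm_eq_abs, abs_mul,
      abs_of_pos (Real.rpow_pos_of_pos hx0 b), Real.rpow_neg hs.le]
    calc (x - s) ^ (a - 1) / Real.Gamma a * |h x| ≤ 1 / Real.Gamma a * |h x| := by gcongr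
      _ = 1 / Real.Gamma a * (s ^ b)⁻¹ * (|h x| * s ^ b) := by field_simp
      _ ≤ _ := by gcongr

/-- The dimension walk in f-form, used with `a = 1/2` and with `a = 1`. The order is a half-integer
step from `-1/2` because the uniform bound is available there; `hab` gives integrability at `0`. -/
theorem integral_fracIntegral_mul_besselH (hh : RapidDecay b h) (n : ℕ) {a ν c : ℝ} (ha : 0 < a)
    (hν : ν = ((n : ℝ) - 1) / 2) (hab : b - 1 < ν + a) (hc : 0 ≤ c) :
    IntegrableOn (fun s => (∫ x in Ioi s, fracIntegrand a h s x) * (s ^ ν * besselH ν (c * s)))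
        (Ioi 0) ∧
      ∫ s in Ioi 0, (∫ x in Ioi s, fracIntegrand a h s x) * (s ^ ν * besselH ν (c * s)) =
        ∫ x in Ioi 0, h x * (x ^ (ν + a) * besselH (ν + a) (c * x)) := by
  have hν1 : -1 < ν := by have := n.cast_nonneg (α := ℝ); linarith
  have hm := measurable_besselH hν1
  obtain ⟨h1, h2⟩ := integral_fracIntegral_mul (k := fun s => s ^ ν * besselH ν (c * s))
    (C := 1 / Real.Gamma (ν + 1)) ha hν1 hh.aestronglyMeasurable (by fun_prop) (fun s hs => by
      rw [abs_mul, abs_of_pos (Real.rpow_pos_of_pos hs ν), mul_comm]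
      gcongr
      rw [hν]
      exact abs_besselH_le n (by positivity)) (hh.integrableOn_mul_rpow hab)
  refine ⟨h1, h2.trans (setIntegral_congr_fun measurableSet_Ioi fun x hx => ?_)⟩
  rw [setIntegral_rpow_mul_besselH ha hν1 hx]

theorem integrableOn_mul_besselH (hh : RapidDecay b h) (n : ℕ) {ν c : ℝ}
    (hν : ν = ((n : ℝ) - 1) / 2) (hb : b - 1 < ν) (hc : 0 ≤ c) :
    IntegrableOn (fun s => h s * (s ^ ν * besselH ν (c * s))) (Ioi 0) := by
  have hν1 : -1 < ν := by have := n.cast_nonneg (α := ℝ); linarith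
  have hm := measurable_besselH hν1
  have h1 := (hh.integrableOn_mul_rpow hb).mul_bdd (c := 1 / Real.Gamma (ν + 1))
    (g := fun s => besselH ν (c * s))
    (by fun_prop : Measurable fun s => besselH ν (c * s)).aestronglyMeasurable (by
      filter_upwards [ae_restrict_mem measurableSet_Ioi] with s hs
      rw [hν]
      exact abs_besselH_le n (mul_nonneg hc (le_of_lt hs)))
  simp only [mul_assoc] at h1
  exact h1

end RapidDecay

/-! ### The substitution `s = t² / 2`. -/

theorem fform_fformInv (F : ℝ → ℝ) {s : ℝ} (hs : 0 ≤ s) : fform (fformInv F) s = F s := by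
  simp only [fform, fformInv]
  rw [Real.sq_sqrt (by positivity), mul_div_cancel_left₀ _ two_ne_zero]

theorem image_sq_div_two_Ioi : (fun t : ℝ => t ^ 2 / 2) '' Ioi 0 = Ioi 0 := by
  ext s
  constructor
  · rintro ⟨t, ht, rfl⟩
    have : 0 < t := ht
    simp only [mem_Ioi]; positivity
  · intro hs
    have hs' : 0 < s := hs
    refine ⟨√(2 * s), Real.sqrt_pos.2 (by positivity), ?_⟩
    simp only
    rw [Real.sq_sqrt (by positivity), mul_div_cancel_left₀ _ two_ne_zero]

theorem injOn_sq_div_two_Ioi : InjOn (fun t : ℝ => t ^ 2 / 2) (Ioi 0) := by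
  intro a ha b hb h
  have h' : a ^ 2 = b ^ 2 := by simpa using h
  exact (pow_left_inj₀ (le_of_lt ha) (le_of_lt hb) two_ne_zero).1 h'

/-- The substitution `s = t² / 2` in the integrand of the radial Fourier transform. -/
theorem mul_radialKernel_eq (d : ℕ) (ψ : ℝ → ℝ) (r : ℝ) {t : ℝ} (ht : 0 < t) :
    ψ t * radialKernel d r t = |t| • (fform ψ (t ^ 2 / 2) * ((t ^ 2 / 2) ^ (((d : ℝ) - 2) / 2) *
      besselH (((d : ℝ) - 2) / 2) (r ^ 2 / 2 * (t ^ 2 / 2)))) := by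
  rw [radialKernel, fform, mul_div_cancel₀ _ two_ne_zero, Real.sqrt_sq ht.le, smul_eq_mul,
    abs_of_pos ht, show (t * r) ^ 2 / 4 = r ^ 2 / 2 * (t ^ 2 / 2) by ring,
    Real.div_rpow (by positivity) zero_le_two, ← Real.rpow_natCast_mul ht.le,
    show (d : ℝ) - 1 = 1 + ((2 : ℕ) : ℝ) * (((d : ℝ) - 2) / 2) by push_cast; ring, Real.rpow_add ht,
    Real.rpow_one, Real.rpow_neg zero_le_two]
  ring

theorem hasDerivWithinAt_sq_div_two (t : ℝ) (s : Set ℝ) :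
    HasDerivWithinAt (fun t : ℝ => t ^ 2 / 2) t s t := by
  have := ((hasDerivAt_pow 2 t).div_const 2).hasDerivWithinAt (s := s)
  simpa using this

theorem integrableOn_mul_radialKernel_iff (d : ℕ) (ψ : ℝ → ℝ) (r : ℝ) :
    IntegrableOn (fun t => ψ t * radialKernel d r t) (Ioi 0) ↔
      IntegrableOn (fun s => fform ψ s * (s ^ (((d : ℝ) - 2) / 2) *
        besselH (((d : ℝ) - 2) / 2) (r ^ 2 / 2 * s))) (Ioi 0) := by
  have e : EqOn (fun t => ψ t * radialKernel d r t) _ (Ioi 0) := fun t ht =>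
    mul_radialKernel_eq d ψ r ht
  rw [integrableOn_congr_fun e measurableSet_Ioi]
  have := integrableOn_image_iff_integrableOn_abs_deriv_smul measurableSet_Ioi
    (fun t _ => hasDerivWithinAt_sq_div_two t (Ioi 0)) injOn_sq_div_two_Ioi
    (fun s => fform ψ s * (s ^ (((d : ℝ) - 2) / 2) *
        besselH (((d : ℝ) - 2) / 2) (r ^ 2 / 2 * s)))
  rw [image_sq_div_two_Ioi] at this
  exact this.symm

theorem radialFourier_eq_integral_fform (d : ℕ) (ψ : ℝ → ℝ) (r : ℝ) :
    radialFourier d ψ r = ∫ s in Ioi 0, fform ψ s * (s ^ (((d : ℝ) - 2) / 2) *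
        besselH (((d : ℝ) - 2) / 2) (r ^ 2 / 2 * s)) := by
  rw [radialFourier, setIntegral_congr_fun measurableSet_Ioi
    (fun t ht => mul_radialKernel_eq d ψ r ht)]
  have := integral_image_eq_integral_abs_deriv_smul measurableSet_Ioi
    (fun t _ => hasDerivWithinAt_sq_div_two t (Ioi 0)) injOn_sq_div_two_Ioi
    (fun s => fform ψ s * (s ^ (((d : ℝ) - 2) / 2) *
        besselH (((d : ℝ) - 2) / 2) (r ^ 2 / 2 * s)))
  rw [image_sq_div_two_Ioi] at this
  exact this.symm

theorem fform_halfI (φ : ℝ → ℝ) {s : ℝ} (hs : 0 ≤ s) :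
    fform (halfI φ) s = ∫ x in Ioi s, fracIntegrand (1 / 2) (fform φ) s x := by
  rw [halfI, fform_fformInv _ hs, fracOp, if_pos (by norm_num), fracIntegral, if_neg (by norm_num)]

theorem fform_halfD (φ : ℝ → ℝ) {s : ℝ} (hs : 0 ≤ s) :
    fform (halfD φ) s = ∫ x in Ioi s, fracIntegrand (1 / 2) (negDeriv (fform φ)) s x := by
  have h1 : ⌈-(-1 / 2 : ℝ)⌉₊ = 1 := by rw [Nat.ceil_eq_iff one_ne_zero]; norm_num
  rw [halfD, fform_fformInv _ hs, fracOp, if_neg (by norm_num), h1, Function.iterate_one,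
    show (((1 : ℕ) : ℝ) + -1 / 2) = 1 / 2 by norm_num, fracIntegral, if_neg (by norm_num)]

/-! ### Decay and derivatives of f-forms. -/

/-- Continuity holds on all of `ℝ` because `√` is `0` on negative numbers. -/
theorem continuous_fform {ψ : ℝ → ℝ} (hψ : ContinuousOn ψ (Ici 0)) : Continuous (fform ψ) :=
  hψ.comp_continuous (by fun_prop) fun _ => Real.sqrt_nonneg _

theorem pow_mul_abs_fform_le {ψ : ℝ → ℝ} {N : ℕ} {C : ℝ}
    (hC : ∀ x : ℝ, 0 ≤ x → |x ^ (2 * N) * ψ x| ≤ C) {s : ℝ} (hs : 0 ≤ s) :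
    s ^ N * |fform ψ s| ≤ C := by
  -- At `x = √(2s)` the power `x ^ (2 * N)` is `(2s) ^ N`, which is at least `s ^ N`.
  have h1 := hC (√(2 * s)) (Real.sqrt_nonneg _)
  rw [abs_mul, pow_mul, Real.sq_sqrt (by positivity), abs_of_nonneg (by positivity)] at h1
  refine le_trans ?_ h1
  rw [fform]
  gcongr
  linarith

theorem rapidDecay_fform {ψ : ℝ → ℝ} (hψ : ContinuousOn ψ (Ici 0))
    (hd : ∀ α : ℕ, ∃ C : ℝ, ∀ x : ℝ, 0 ≤ x → |x ^ α * ψ x| ≤ C) : RapidDecay 0 (fform ψ) where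
  aestronglyMeasurable := (continuous_fform hψ).aestronglyMeasurable
  bound N := by
    obtain ⟨C, hC⟩ := hd (2 * N)
    refine ⟨C, fun s hs => ?_⟩
    rw [neg_zero, Real.rpow_zero, mul_one]
    exact pow_mul_abs_fform_le hC hs.le

theorem rapidDecay_of_eq_div_sqrt {g h : ℝ → ℝ} (hg : RapidDecay 0 g)
    (hh : ∀ s, 0 < s → h s = g s / √(2 * s)) : RapidDecay (1 / 2) h where
  aestronglyMeasurable := by
    have hm : AEStronglyMeasurable (fun s => g s / √(2 * s)) (volume.restrict (Ioi 0)) := by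
      simp_rw [div_eq_mul_inv]
      exact hg.aestronglyMeasurable.mul
        (by fun_prop : Measurable fun s : ℝ => (√(2 * s))⁻¹).aestronglyMeasurable
    refine hm.congr ?_
    filter_upwards [ae_restrict_mem measurableSet_Ioi] with s hs using (hh s hs).symm
  bound N := by
    obtain ⟨C, hC⟩ := hg.bound N
    refine ⟨C, fun s hs => ?_⟩
    have h1 := hC s hs
    rw [neg_zero, Real.rpow_zero, mul_one] at h1
    have hC0 : 0 ≤ C := le_trans (by positivity) h1
    have hs0 := Real.sqrt_pos.2 hs
    have h2 : √s ≤ √(2 * s) := Real.sqrt_le_sqrt (by linarith)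
    rw [hh s hs, abs_div, abs_of_nonneg (Real.sqrt_nonneg _), Real.rpow_neg hs.le,
      ← Real.sqrt_eq_rpow, ← mul_div_assoc, ← div_eq_mul_inv]
    gcongr

theorem hasDerivAt_fform {φ : ℝ → ℝ} (hφ : DifferentiableOn ℝ φ (Ici 0)) {s : ℝ} (hs : 0 < s) :
    HasDerivAt (fform φ) (fform (derivWithin φ (Ici 0)) s / √(2 * s)) s := by
  have hs0 : 0 < √(2 * s) := Real.sqrt_pos.2 (by positivity)
  have h1 : HasDerivAt φ (derivWithin φ (Ici 0) (√(2 * s))) (√(2 * s)) :=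
    (hφ _ hs0.le).hasDerivWithinAt.hasDerivAt (Ici_mem_nhds hs0)
  have h2 : HasDerivAt (fun s : ℝ => √(2 * s)) (2 * 1 / (2 * √(2 * s))) s :=
    ((hasDerivAt_id s).const_mul 2).sqrt (by simp only [id]; positivity)
  have h3 := h1.comp s h2
  rw [mul_div_mul_left _ _ two_ne_zero, mul_one_div] at h3
  exact h3

theorem negDeriv_eq_neg_deriv (g : ℝ → ℝ) {s : ℝ} (hs : 0 < s) : negDeriv g s = -deriv g s := by
  rw [negDeriv, derivWithin_of_mem_nhds (Ici_mem_nhds hs)]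

theorem fracIntegrand_one (h : ℝ → ℝ) (s : ℝ) : fracIntegrand 1 h s = h := by
  ext x; simp [fracIntegrand]

/-- This is `I_1 I_{-1} = id`: the fundamental theorem of calculus, with no boundary term at
infinity by rapid decay. -/
theorem integral_negDeriv {g : ℝ → ℝ} {b : ℝ} (hg : RapidDecay 0 g) (hb : 0 ≤ b)
    (hd : ∀ s, 0 < s → DifferentiableAt ℝ g s) (hg' : RapidDecay b (negDeriv g)) {s : ℝ}
    (hs : 0 < s) : ∫ x in Ioi s, negDeriv g x = g s := by
  have hlim : Filter.Tendsto g Filter.atTop (nhds 0) := by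
    obtain ⟨C, hC⟩ := hg.bound 1
    refine squeeze_zero_norm' (a := fun x => C / x) ?_ (Filter.tendsto_id.const_div_atTop C)
    filter_upwards [Filter.eventually_gt_atTop 0] with x hx
    have h1 := hC x hx
    rw [neg_zero, Real.rpow_zero, mul_one, pow_one, mul_comm] at h1
    rwa [Real.norm_eq_abs, le_div_iff₀ hx]
  have hi := hg'.integrableOn_fracIntegrand hb one_pos le_rfl hs
  rw [fracIntegrand_one] at hi
  have h1 : ∀ x ∈ Ioi s, negDeriv g x = -deriv g x := fun x hx =>
    negDeriv_eq_neg_deriv g (hs.trans hx)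
  have hi' : IntegrableOn (deriv g) (Ioi s) := by
    have := ((integrableOn_congr_fun h1 measurableSet_Ioi).1 hi).neg
    refine this.congr (Filter.Eventually.of_forall fun x => ?_)
    simp
  rw [setIntegral_congr_fun measurableSet_Ioi h1, integral_neg,
    integral_Ioi_of_hasDerivAt_of_tendsto' (fun x hx => (hd x (hs.trans_le hx)).hasDerivAt) hi' hlim]
  ring

/-! ### The dimension walk for test functions. -/

namespace TemperedRadial

variable {φ : ℝ → ℝ}

theorem differentiableOn (hφ : φ ∈ TemperedRadial) : DifferentiableOn ℝ φ (Ici 0) :=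
  hφ.1.differentiableOn (by simp)

theorem rapidDecay_fform (hφ : φ ∈ TemperedRadial) : RapidDecay 0 (fform φ) :=
  _root_.rapidDecay_fform hφ.1.continuousOn fun α => by
    simpa only [iteratedDerivWithin_zero] using hφ.2 α 0

theorem rapidDecay_negDeriv_fform (hφ : φ ∈ TemperedRadial) :
    RapidDecay (1 / 2) (negDeriv (fform φ)) := by
  have h1 : RapidDecay 0 (fform (derivWithin φ (Ici 0))) :=
    _root_.rapidDecay_fform (hφ.1.continuousOn_derivWithin (uniqueDiffOn_Ici 0) (by simp))
      fun α => by simpa only [iteratedDerivWithin_one] using hφ.2 α 1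
  have h2 : RapidDecay 0 fun s => -fform (derivWithin φ (Ici 0)) s :=
    ⟨h1.aestronglyMeasurable.neg, by simpa only [abs_neg] using h1.bound⟩
  refine rapidDecay_of_eq_div_sqrt h2 fun s hs => ?_
  rw [negDeriv_eq_neg_deriv _ hs, (hasDerivAt_fform (differentiableOn hφ) hs).deriv, neg_div]

theorem radialFourier_halfI (hφ : φ ∈ TemperedRadial) {d : ℕ} (hd : 1 ≤ d) {r : ℝ} :
    IntegrableOn (fun t => halfI φ t * radialKernel d r t) (Ioi 0) ∧
      radialFourier d (halfI φ) r = radialFourier (d + 1) φ r := by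
  obtain ⟨n, rfl⟩ := Nat.exists_eq_add_of_le' hd
  have hn := n.cast_nonneg (α := ℝ)
  obtain ⟨h1, h2⟩ := (rapidDecay_fform hφ).integral_fracIntegral_mul_besselH n
    (a := 1 / 2) (ν := (((n + 1 : ℕ) : ℝ) - 2) / 2) (c := r ^ 2 / 2) (by norm_num)
    (by push_cast; ring) (by push_cast; linarith) (by positivity)
  have e : ∀ s ∈ Ioi (0 : ℝ), _ := fun s hs => fform_halfI φ (le_of_lt hs)
  rw [integrableOn_mul_radialKernel_iff, radialFourier_eq_integral_fform,
    radialFourier_eq_integral_fform]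
  refine ⟨(integrableOn_congr_fun (fun s hs => ?_) measurableSet_Ioi).1 h1,
    (setIntegral_congr_fun measurableSet_Ioi fun s hs => ?_).trans (h2.trans ?_)⟩
  · simp only [e s hs]
  · simp only [e s hs]
  · rw [show (((n + 1 + 1 : ℕ) : ℝ) - 2) / 2 = (((n + 1 : ℕ) : ℝ) - 2) / 2 + 1 / 2 by
      push_cast; ring]

theorem radialFourier_halfD (hφ : φ ∈ TemperedRadial) {d : ℕ} (hd : 1 ≤ d) {r : ℝ} :
    IntegrableOn (fun t => halfD φ t * radialKernel (d + 1) r t) (Ioi 0) ∧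
      radialFourier (d + 1) (halfD φ) r = radialFourier d φ r := by
  obtain ⟨n, rfl⟩ := Nat.exists_eq_add_of_le' hd
  have hn := n.cast_nonneg (α := ℝ)
  have hg' := rapidDecay_negDeriv_fform hφ
  -- `h2` and `h3` move `I_{1/2}` and `I_1` onto kernels of orders `d/2 - 1/2` and `d/2 - 1`; both
  -- arrive at order `d/2`.
  obtain ⟨h1, h2⟩ := hg'.integral_fracIntegral_mul_besselH (n + 1)
    (a := 1 / 2) (ν := (((n + 1 + 1 : ℕ) : ℝ) - 2) / 2) (c := r ^ 2 / 2) (by norm_num)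
    (by push_cast; ring) (by push_cast; linarith) (by positivity)
  have h3 := (hg'.integral_fracIntegral_mul_besselH n
    (a := 1) (ν := (((n + 1 : ℕ) : ℝ) - 2) / 2) (c := r ^ 2 / 2) (by norm_num)
    (by push_cast; ring) (by push_cast; linarith) (by positivity)).2
  have e : ∀ s ∈ Ioi (0 : ℝ), _ := fun s hs => fform_halfD φ (le_of_lt hs)
  have e' : ∀ s ∈ Ioi (0 : ℝ), _ := fun s hs => integral_negDeriv (rapidDecay_fform hφ)
    (by norm_num) (fun s hs => (hasDerivAt_fform (differentiableOn hφ) hs).differentiableAt) hg' hs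
  rw [integrableOn_mul_radialKernel_iff, radialFourier_eq_integral_fform,
    radialFourier_eq_integral_fform]
  refine ⟨(integrableOn_congr_fun (fun s hs => ?_) measurableSet_Ioi).1 h1,
    (setIntegral_congr_fun measurableSet_Ioi fun s hs => ?_).trans (h2.trans (Eq.trans ?_
      (h3.symm.trans (setIntegral_congr_fun measurableSet_Ioi fun s hs => ?_))))⟩
  · simp only [e s hs]
  · simp only [e s hs]
  · rw [show (((n + 1 + 1 : ℕ) : ℝ) - 2) / 2 + 1 / 2 = (((n + 1 : ℕ) : ℝ) - 2) / 2 + 1 by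
      push_cast; ring]
  · simp only [fracIntegrand_one, e' s hs]

theorem radialFourierExists (hφ : φ ∈ TemperedRadial) {d : ℕ} (hd : 1 ≤ d) :
    RadialFourierExists d φ := by
  intro r _
  obtain ⟨n, rfl⟩ := Nat.exists_eq_add_of_le' hd
  have hn := n.cast_nonneg (α := ℝ)
  rw [integrableOn_mul_radialKernel_iff]
  exact (rapidDecay_fform hφ).integrableOn_mul_besselH n (by push_cast; ring)
    (by push_cast; linarith) (by positivity)

theorem integrableOn_fracIntegrand_fform (hφ : φ ∈ TemperedRadial) {s : ℝ} (hs : 0 ≤ s) :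
    IntegrableOn (fracIntegrand (1 / 2) (fform φ) s) (Ioi s) := by
  rcases hs.eq_or_lt with rfl | hs
  -- At `s = 0` the kernel is `x ^ (-1/2) / Γ(1/2)`, integrable near `0` against the bounded f-form.
  · have := ((rapidDecay_fform hφ).integrableOn_mul_rpow (p := 1 / 2 - 1) (by norm_num)).div_const
      (Real.Gamma (1 / 2))
    refine this.congr (Filter.Eventually.of_forall fun x => ?_)
    simp only [fracIntegrand, sub_zero]
    ring
  · exact (rapidDecay_fform hφ).integrableOn_fracIntegrand le_rfl (by norm_num) (by norm_num) hs

end TemperedRadial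

/-- The first four conjuncts say that the functions and integrals involved exist; the last two are
the dimension walk. `𝒟^{1/2} φ(t)` is a convergent integral for every `t > 0`
(at `t = 0` it may diverge, which does not affect its Fourier transform). -/
theorem theorem2p3 (φ : ℝ → ℝ) (hφ : φ ∈ TemperedRadial) :
    (∀ s : ℝ, 0 < s → DifferentiableAt ℝ (fform φ) s ∧
      IntegrableOn (fracIntegrand (1 / 2) (negDeriv (fform φ)) s) (Ioi s)) ∧
    (∀ s : ℝ, 0 ≤ s → IntegrableOn (fracIntegrand (1 / 2) (fform φ) s) (Ioi s)) ∧
    (∀ d : ℕ, 1 ≤ d → RadialFourierExists d φ ∧ RadialFourierExists (d + 1) (halfD φ)) ∧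
    (∀ d : ℕ, 2 ≤ d → RadialFourierExists (d - 1) (halfI φ)) ∧
    (∀ d : ℕ, 1 ≤ d → ∀ r : ℝ, 0 ≤ r →
      radialFourier d φ r = radialFourier (d + 1) (halfD φ) r) ∧
    (∀ d : ℕ, 2 ≤ d → ∀ r : ℝ, 0 ≤ r →
      radialFourier d φ r = radialFourier (d - 1) (halfI φ) r) := by
  refine ⟨fun s hs => ⟨(hasDerivAt_fform (TemperedRadial.differentiableOn hφ) hs).differentiableAt,
      (TemperedRadial.rapidDecay_negDeriv_fform hφ).integrableOn_fracIntegrand (by norm_num)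
        (by norm_num) (by norm_num) hs⟩,
    fun s hs => TemperedRadial.integrableOn_fracIntegrand_fform hφ hs,
    fun d hd => ⟨TemperedRadial.radialFourierExists hφ hd,
      fun r _ => (TemperedRadial.radialFourier_halfD hφ hd).1⟩,
    fun d hd r _ => (TemperedRadial.radialFourier_halfI hφ (by omega)).1,
    fun d hd r _ => (TemperedRadial.radialFourier_halfD hφ hd).2.symm, fun d hd r _ => ?_⟩
  obtain ⟨n, rfl⟩ := Nat.exists_eq_add_of_le' (show 1 ≤ d by omega)
  exact (TemperedRadial.radialFourier_halfI hφ (by omega)).2.symm
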